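/- Let $\mathbb{T}\subseteq\mathbb{R}$ and, for each $x\in\mathbb{T}$, let $\mathbb{S}_x\subseteq\mathbb{R}$. Assume that these sets are discrete uniformly in the target: there is a constant $\alpha>0$, not depending on $x$, such that $|z-x|\ge\alpha$ for all $x\in\mathbb{T}$ and all $z\in(\mathbb{T}\cup\mathbb{S}_x)\setminus\{x\}$. Let $f$ be a probability mass function (pmf) supported in $\mathbb{T}$ and let $X_1,X_2,\ldots$ be i.i.d. random variables with pmf $f$. For every $x\in\mathbb{T}$ and $h>0$ let $K_{x,h}$ be a pmf supported in $\mathbb{S}_x$, and let $Z_{x,h}$ be a random variable with pmf $K_{x,h}$. Let $(h_n)_{n\ge1}$ be a sequence of positive numbers, and put $$\widetilde f_n(x)=\frac1n\sum_{i=1}^nK_{x,h_n}(X_i),\qquad C_n=\sum_{x\in\mathbb{T}}\widetilde f_n(x),\qquad \widehat f_n(x)=\frac{\widetilde f_n(x)}{C_n},\qquad x\in\mathbb{T}$$ (with the convention $\widehat f_n(x)=0$ when $C_n\in\{0,\infty\}$). Assume **(A2)** $x\in\mathbb{S}_x$ for all $x\in\mathbb{T}$, and, as $n\to\infty$, $$\sup_{x\in\mathbb{T}}\left|\mathbb{E}(Z_{x,h_n})-x\right|=\mathcal{O}(h_n)\quad\text{and}\quad\sup_{x\in\mathbb{T}}\mathrm{Var}(Z_{x,h_n})=\mathcal{O}(h_n)$$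 (in particular, for all large $n$, $Z_{x,h_n}$ has a finite second moment for every $x\in\mathbb{T}$). If $\sqrt n\,h_n\to0$ as $n\to\infty$, then for every $x\in\mathbb{T}$ with $f(x)>0$, the sequence $\sqrt n\,(\widehat f_n(x)-f(x))$ converges in distribution, as $n\to\infty$, to the normal distribution $\mathcal{N}(0,f(x)\{1-f(x)\})$ (the point mass at $0$ if $f(x)=1$). -/

import Mathlib

open MeasureTheory ProbabilityTheory Filter Topology

noncomputable section

namespace DiscreteKernel

/-- The discreteness of the target set `T` and of the kernel supports `S x`: there is a constant
`α > 0`, not depending on the target `x ∈ T`, such that every point of `T ∪ S x` other than `x`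
is at distance at least `α` from `x`. -/
def UniformlyDiscrete (T : Set ℝ) (S : ℝ → Set ℝ) : Prop :=
  ∃ α : ℝ, 0 < α ∧ ∀ x ∈ T, ∀ z ∈ (T ∪ S x) \ {x}, α ≤ |z - x|

/-- `K x h` is a pmf on the support `S x`, for every target `x ∈ T` and bandwidth `h > 0`. -/
def IsKernelOn (T : Set ℝ) (S : ℝ → Set ℝ) (K : ℝ → ℝ → PMF ℝ) : Prop :=
  ∀ x ∈ T, ∀ h : ℝ, 0 < h → (K x h).support ⊆ S x

/-- The mean `E(Z_{x,h})` of a random variable with pmf `K x h`. -/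
def kernelMean (K : ℝ → ℝ → PMF ℝ) (x h : ℝ) : ℝ := ∫ z, z ∂(K x h).toMeasure

/-- The variance `Var(Z_{x,h})` of a random variable with pmf `K x h`. -/
def kernelVar (K : ℝ → ℝ → PMF ℝ) (x h : ℝ) : ℝ := Var[fun z : ℝ => z; (K x h).toMeasure]

/-- `x ∈ S x` for every target `x`, and `sup_{x ∈ T} |E(Z_{x,h_n}) - x| = O(h_n)` and
`sup_{x ∈ T} Var(Z_{x,h_n}) = O(h_n)` as `n → ∞`. The field `moment` says that the means and
variances in question exist (as finite numbers) for all large `n`. -/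
structure AssumptionA2 (T : Set ℝ) (S : ℝ → Set ℝ) (K : ℝ → ℝ → PMF ℝ) (h : ℕ → ℝ) : Prop where
  mem_support : ∀ x ∈ T, x ∈ S x
  moment : ∀ᶠ n in atTop, ∀ x ∈ T, MemLp (fun z : ℝ => z) 2 (K x (h n)).toMeasure
  bias : ∃ c : ℝ, ∀ᶠ n in atTop, ∀ x ∈ T, |kernelMean K x (h n) - x| ≤ c * h n
  variance : ∃ c : ℝ, ∀ᶠ n in atTop, ∀ x ∈ T, kernelVar K x (h n) ≤ c * h n

/-- The non-normalized estimator `(1/n) ∑_{i=1}^n K_{x,h_n}(X_i)`; the sample `X_1, …, X_n` is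
indexed here by `0, …, n - 1`. -/
def fTilde {Ω : Type*} (K : ℝ → ℝ → PMF ℝ) (h : ℕ → ℝ) (X : ℕ → Ω → ℝ)
    (n : ℕ) (x : ℝ) (ω : Ω) : ℝ :=
  (1 / (n : ℝ)) * ∑ i ∈ Finset.range n, (K x (h n) (X i ω)).toReal

/-- The normalizing random variable, the sum of the non-normalized estimator over all targets. -/
def normConst {Ω : Type*} (T : Set ℝ) (K : ℝ → ℝ → PMF ℝ) (h : ℕ → ℝ) (X : ℕ → Ω → ℝ)
    (n : ℕ) (ω : Ω) : ℝ :=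
  ∑' x : T, fTilde K h X n x ω

/-- The normalized estimator. -/
def fHat {Ω : Type*} (T : Set ℝ) (K : ℝ → ℝ → PMF ℝ) (h : ℕ → ℝ) (X : ℕ → Ω → ℝ)
    (n : ℕ) (x : ℝ) (ω : Ω) : ℝ :=
  fTilde K h X n x ω / normConst T K h X n ω

end DiscreteKernel

end

namespace DiscreteKernel

/-! At the scale `√n` the kernels are indistinguishable from point masses. By (A2) the second moment
of `K y (h n)` about `y` is variance plus squared bias, hence `O(h n)` uniformly in `y`. Markov's
inequality and the gap `α` then bound the mass off `y` by `O(h n)`, and the mass at a target `z ≠ y`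
by `O(h n) / (z - y) ^ 2`. Inverse squares of distances between separated points have uniformly
bounded sums, so at every sample value in `T` the kernels of all targets add up to `1 + O(h n)`.
Thus the numerator is the empirical frequency of `x` up to `O(h n)`, and the normalizing sum is `1 +
O(h n)`. The estimator differs from the empirical frequency by `O(h n)`
(`exists_abs_fHat_sub_empiricalFreq_le`), which `√n` times still sends to `0`; Slutsky's theorem
transfers the central limit theorem for Bernoulli indicators. -/

/-- A summable weight on `ℤ` dominating `u⁻²` whenever `1 ≤ |u|` and `k = ⌊u⌋`. -/
noncomputable def latticeWeight (k : ℤ) : ℝ := if k = 0 then 1 else 4 * (1 / (k : ℝ) ^ 2)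

lemma latticeWeight_nonneg (k : ℤ) : 0 ≤ latticeWeight k := by
  unfold latticeWeight
  split_ifs <;> positivity

lemma summable_latticeWeight : Summable latticeWeight := by
  have h1 : Summable fun k : ℤ => 4 * (1 / (k : ℝ) ^ 2) :=
    (Real.summable_one_div_int_pow.2 one_lt_two).mul_left 4
  have h2 : Summable fun k : ℤ => if k = 0 then (1 : ℝ) else 0 :=
    (hasSum_ite_eq (0 : ℤ) (1 : ℝ)).summable
  refine (h1.add h2).congr fun k => ?_
  unfold latticeWeight
  split_ifs with hk <;> simp [hk]

lemma one_div_sq_le_latticeWeight_floor {u : ℝ} (hu : 1 ≤ |u|) :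
    1 / u ^ 2 ≤ latticeWeight ⌊u⌋ := by
  have hle := Int.floor_le u
  have hlt := Int.lt_floor_add_one u
  have hk : ⌊u⌋ ≠ 0 := by
    intro h0
    rw [h0] at hle hlt
    norm_num at hle hlt
    rw [abs_of_nonneg hle] at hu
    linarith
  have hk2 : (0 : ℝ) < (⌊u⌋ : ℝ) ^ 2 := by positivity
  have hu2 : 0 < u ^ 2 := by rw [← sq_abs]; positivity
  rw [latticeWeight, if_neg hk, mul_one_div, div_le_div_iff₀ hu2 hk2]
  -- Rounding moves `u` by less than `1 ≤ |u|`; squaring gives the factor `4` of the weight.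
  have : |(⌊u⌋ : ℝ)| ≤ |2 * u| := by
    rw [abs_mul, abs_two]
    rcases abs_cases u with h | h <;> rcases abs_cases (⌊u⌋ : ℝ) with h' | h' <;> linarith
  have := sq_le_sq.2 this
  linarith

/-- Two points in the same cell of length `α` would be less than `α` apart. Sums over `T` can
therefore be compared with sums over `ℤ`, uniformly in `z`. -/
lemma injective_floor_of_separated {T : Set ℝ} {α : ℝ} (hα : 0 < α)
    (hsep : ∀ y ∈ T, ∀ z ∈ T, z ≠ y → α ≤ |z - y|) (z : ℝ) :
    Function.Injective fun y : T => ⌊((y : ℝ) - z) / α⌋ := by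
  intro y y' hyy
  by_contra hne
  have h1 := Int.abs_sub_lt_one_of_floor_eq_floor hyy
  have h2 := hsep y' y'.2 y y.2 fun h => hne (Subtype.ext h)
  rw [← sub_div, abs_div, abs_of_pos hα, div_lt_one hα] at h1
  have : (y : ℝ) - z - (y' - z) = y - y' := by ring
  rw [this] at h1
  linarith

lemma countable_of_separated {T : Set ℝ} {α : ℝ} (hα : 0 < α)
    (hsep : ∀ y ∈ T, ∀ z ∈ T, z ≠ y → α ≤ |z - y|) : Countable T :=
  (injective_floor_of_separated hα hsep 0).countable

/-! ### Second moments and Markov bounds for a single kernel -/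

section Chebyshev

variable {k : PMF ℝ} {y D : ℝ}

lemma integrable_sub_sq (hk : MemLp (fun z : ℝ => z) 2 k.toMeasure) (y : ℝ) :
    Integrable (fun z : ℝ => (z - y) ^ 2) k.toMeasure :=
  (hk.sub (memLp_const y)).integrable_sq

lemma integral_sub_sq_eq (hk : MemLp (fun z : ℝ => z) 2 k.toMeasure) (y : ℝ) :
    ∫ z, (z - y) ^ 2 ∂k.toMeasure =
      Var[fun z : ℝ => z; k.toMeasure] + (∫ z, z ∂k.toMeasure - y) ^ 2 := by
  have h1 : Var[fun z : ℝ => z - y; k.toMeasure] = Var[fun z : ℝ => z; k.toMeasure] :=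
    variance_sub_const hk.aestronglyMeasurable y
  have h2 := variance_eq_sub (hk.sub (memLp_const y))
  have h3 : ∫ z, (z - y) ∂k.toMeasure = ∫ z, z ∂k.toMeasure - y := by
    rw [integral_sub (hk.integrable one_le_two) (integrable_const y)]
    simp
  simp only [Pi.sub_def, Pi.pow_def] at h2
  rw [h1, h3] at h2
  linarith

lemma measureReal_singleton_eq (k : PMF ℝ) (z : ℝ) :
    k.toMeasure.real {z} = (k z).toReal := by
  rw [measureReal_def, k.toMeasure_apply_singleton z (measurableSet_singleton z)]

lemma sub_sq_mul_apply_le (hint : Integrable (fun z : ℝ => (z - y) ^ 2) k.toMeasure)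
    (hD : ∫ z, (z - y) ^ 2 ∂k.toMeasure ≤ D) (z : ℝ) :
    (z - y) ^ 2 * (k z).toReal ≤ D := by
  refine le_trans ?_ ((mul_meas_ge_le_integral_of_nonneg
    (ae_of_all _ fun w => sq_nonneg (w - y)) hint ((z - y) ^ 2)).trans hD)
  rw [← measureReal_singleton_eq]
  refine mul_le_mul_of_nonneg_left (measureReal_mono ?_) (sq_nonneg _)
  rintro w rfl
  exact le_refl ((w - y) ^ 2)

lemma sq_mul_one_sub_apply_le {s : Set ℝ} {α : ℝ} (hα : 0 < α) (hs : k.support ⊆ s)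
    (hsep : ∀ z ∈ s \ {y}, α ≤ |z - y|)
    (hint : Integrable (fun z : ℝ => (z - y) ^ 2) k.toMeasure)
    (hD : ∫ z, (z - y) ^ 2 ∂k.toMeasure ≤ D) :
    α ^ 2 * (1 - (k y).toReal) ≤ D := by
  refine le_trans ?_ ((mul_meas_ge_le_integral_of_nonneg
    (ae_of_all _ fun w => sq_nonneg (w - y)) hint (α ^ 2)).trans hD)
  rw [← measureReal_singleton_eq, ← probReal_compl_eq_one_sub (measurableSet_singleton y)]
  refine mul_le_mul_of_nonneg_left ?_ (sq_nonneg _)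
  refine ENNReal.toReal_mono (measure_ne_top _ _) ?_
  refine k.toMeasure_mono (measurableSet_singleton y).compl ?_
  rintro w ⟨hwy, hw⟩
  have := hsep w ⟨hs hw, hwy⟩
  exact (sq_le_sq.2 (by rwa [abs_of_pos hα]) : α ^ 2 ≤ (w - y) ^ 2)

lemma apply_toReal_le_one (k : PMF ℝ) (z : ℝ) : (k z).toReal ≤ 1 :=
  ENNReal.toReal_le_of_le_ofReal zero_le_one (by simpa using k.coe_le_one z)

/-- The support is countable, so the pmf is a countable sum of multiples of indicators of points. -/
lemma measurable_pmf (k : PMF ℝ) : Measurable k := by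
  have : (k : ℝ → ENNReal) = fun z =>
      ∑' a : k.support, ({(a : ℝ)} : Set ℝ).indicator (fun _ => k a) z := by
    funext z
    by_cases hz : z ∈ k.support
    · rw [tsum_eq_single ⟨z, hz⟩]
      · simp
      · intro b hb
        refine Set.indicator_of_notMem (fun h => hb (Subtype.ext h.symm)) _
    · rw [(k.apply_eq_zero_iff z).2 hz, eq_comm, ENNReal.tsum_eq_zero]
      intro b
      refine Set.indicator_of_notMem (fun h => hz ?_) _
      rw [h]
      exact b.2
  rw [this]
  have := k.support_countable.to_subtype
  exact Measurable.tsum fun a => measurable_const.indicator (measurableSet_singleton _)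

end Chebyshev

/-- Closeness of a kernel `k` on the targets `T` to the Dirac kernel, quantified by the
common bound `D` on its second moments around the targets. -/
lemma abs_kernel_sub_indicator_le {T : Set ℝ} {S : ℝ → Set ℝ} {α D : ℝ} (hα : 0 < α)
    (hsep : ∀ y ∈ T, ∀ z ∈ (T ∪ S y) \ {y}, α ≤ |z - y|)
    {k : ℝ → PMF ℝ} (hk : ∀ y ∈ T, (k y).support ⊆ S y)
    (hint : ∀ y ∈ T, Integrable (fun z : ℝ => (z - y) ^ 2) (k y).toMeasure)
    (hD : ∀ y ∈ T, ∫ z, (z - y) ^ 2 ∂(k y).toMeasure ≤ D)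
    {y z : ℝ} (hy : y ∈ T) (hz : z ∈ T) :
    |(k y z).toReal - ({y} : Set ℝ).indicator 1 z| ≤
      D / α ^ 2 * latticeWeight ⌊(y - z) / α⌋ ∧
    |(k y z).toReal - ({y} : Set ℝ).indicator 1 z| ≤ D / α ^ 2 := by
  have hα2 : 0 < α ^ 2 := by positivity
  by_cases hyz : z = y
  · subst hyz
    have h1 := sq_mul_one_sub_apply_le hα (hk z hy)
      (fun w hw => hsep z hy w ⟨Or.inr hw.1, hw.2⟩) (hint z hy) (hD z hy)
    have h2 := apply_toReal_le_one (k z) z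
    have h3 : |(k z z).toReal - ({z} : Set ℝ).indicator 1 z| ≤ D / α ^ 2 := by
      rw [Set.indicator_of_mem (Set.mem_singleton z), Pi.one_apply, abs_sub_comm,
        abs_of_nonneg (by linarith), le_div_iff₀ hα2]
      linarith
    refine ⟨?_, h3⟩
    -- On the diagonal the cell index is `0`, where the weight equals `1`.
    simpa [latticeWeight] using h3
  · have h1 := sub_sq_mul_apply_le (hint y hy) (hD y hy) z
    have h2 := hsep y hy z ⟨Or.inl hz, hyz⟩
    have h0 : 0 ≤ (k y z).toReal := ENNReal.toReal_nonneg
    have hD0 : 0 ≤ D := le_trans (by positivity) h1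
    rw [Set.indicator_of_notMem (by simpa using hyz), sub_zero, abs_of_nonneg h0]
    have hsq : α ^ 2 ≤ (z - y) ^ 2 := sq_le_sq.2 (by rwa [abs_of_pos hα])
    have hu : 1 ≤ |(y - z) / α| := by
      rw [abs_div, abs_of_pos hα, one_le_div hα, abs_sub_comm]
      exact h2
    constructor
    · calc (k y z).toReal ≤ D / (z - y) ^ 2 := by
            rw [le_div_iff₀ (by linarith)]
            linarith
        _ = D / α ^ 2 * (1 / ((y - z) / α) ^ 2) := by
            have : (y - z) ^ 2 = (z - y) ^ 2 := by ring
            rw [div_pow, this]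
            field_simp
        _ ≤ _ := mul_le_mul_of_nonneg_left (one_div_sq_le_latticeWeight_floor hu) (by positivity)
    · rw [le_div_iff₀ hα2]
      nlinarith

/-- For an almost Dirac kernel, the total mass that the targets give to a target is summable and
close to one. -/
lemma summable_and_abs_tsum_kernel_sub_one_le {T : Set ℝ} {α E : ℝ} (hα : 0 < α)
    (hsep : ∀ y ∈ T, ∀ z ∈ T, z ≠ y → α ≤ |z - y|) (hE : 0 ≤ E) {k : ℝ → PMF ℝ}
    {z : ℝ} (hz : z ∈ T)
    (hk : ∀ y ∈ T, |(k y z).toReal - ({y} : Set ℝ).indicator 1 z| ≤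
      E * latticeWeight ⌊(y - z) / α⌋) :
    Summable (fun y : T => (k y z).toReal) ∧
      |∑' y : T, (k y z).toReal - 1| ≤ E * ∑' j, latticeWeight j := by
  have hinj := injective_floor_of_separated hα hsep z
  have hw : Summable fun y : T => latticeWeight ⌊((y : ℝ) - z) / α⌋ :=
    summable_latticeWeight.comp_injective hinj
  have hdom : Summable fun y : T => E * latticeWeight ⌊((y : ℝ) - z) / α⌋ := hw.mul_left E
  have hnorm : ∀ y : T, ‖(k y z).toReal - ({(y : ℝ)} : Set ℝ).indicator 1 z‖ ≤
      E * latticeWeight ⌊((y : ℝ) - z) / α⌋ := fun y => hk y y.2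
  have hdiff := Summable.of_norm_bounded hdom hnorm
  have hone : HasSum (fun y : T => ({(y : ℝ)} : Set ℝ).indicator (1 : ℝ → ℝ) z) 1 := by
    convert hasSum_ite_eq (⟨z, hz⟩ : T) (1 : ℝ) using 2 with y
    by_cases hy : z = y
    · subst hy
      simp
    · rw [Set.indicator_of_notMem (by simpa using hy), if_neg]
      exact fun h => hy (congrArg Subtype.val h).symm
  have hsum : Summable (fun y : T => (k y z).toReal) := by
    simpa using hdiff.add hone.summable
  refine ⟨hsum, ?_⟩
  rw [← hone.tsum_eq, ← hsum.tsum_sub hone.summable]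
  refine (tsum_of_norm_bounded hdom.hasSum hnorm).trans ?_
  rw [tsum_mul_left]
  refine mul_le_mul_of_nonneg_left ?_ hE
  exact tsum_comp_le_tsum_of_inj summable_latticeWeight latticeWeight_nonneg hinj

/-! ### Comparison with the empirical frequency -/

/-- Averages of terms that are uniformly close are close. -/
lemma abs_average_sub_average_le {n : ℕ} (hn : n ≠ 0) {a b : ℕ → ℝ} {E : ℝ}
    (hab : ∀ i, |a i - b i| ≤ E) :
    |1 / (n : ℝ) * ∑ i ∈ Finset.range n, a i - 1 / (n : ℝ) * ∑ i ∈ Finset.range n, b i| ≤ E := by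
  have hn' : (0 : ℝ) < n := by positivity
  rw [← mul_sub, ← Finset.sum_sub_distrib, abs_mul, abs_of_pos (by positivity), one_div,
    inv_mul_le_iff₀ hn']
  refine (Finset.abs_sum_le_sum_abs _ _).trans ((Finset.sum_le_sum fun i _ => hab i).trans ?_)
  simp

/-- The empirical frequency of the value `x` in the sample. -/
noncomputable def empiricalFreq {Ω : Type*} (X : ℕ → Ω → ℝ) (n : ℕ) (x : ℝ) (ω : Ω) : ℝ :=
  1 / (n : ℝ) * ∑ i ∈ Finset.range n, ({x} : Set ℝ).indicator 1 (X i ω)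

lemma empiricalFreq_nonneg {Ω : Type*} (X : ℕ → Ω → ℝ) (n : ℕ) (x : ℝ) (ω : Ω) :
    0 ≤ empiricalFreq X n x ω :=
  mul_nonneg (by positivity)
    (Finset.sum_nonneg fun _ _ => Set.indicator_nonneg (fun _ _ => zero_le_one) _)

lemma empiricalFreq_le_one {Ω : Type*} (X : ℕ → Ω → ℝ) {n : ℕ} (hn : n ≠ 0) (x : ℝ) (ω : Ω) :
    empiricalFreq X n x ω ≤ 1 := by
  have hn' : (0 : ℝ) < n := by positivity
  rw [empiricalFreq, one_div, inv_mul_le_iff₀ hn']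
  calc ∑ i ∈ Finset.range n, ({x} : Set ℝ).indicator (1 : ℝ → ℝ) (X i ω)
      ≤ ∑ _i ∈ Finset.range n, (1 : ℝ) :=
        Finset.sum_le_sum fun i _ => Set.indicator_le_self' (fun _ _ => zero_le_one) _
    _ = n * 1 := by simp

/-- The error is `((a - p) - p * (c - 1)) / c`, and `c ≥ 1 / 2` costs the factor `2`. -/
lemma abs_div_sub_le {a c p E F : ℝ} (hp : 0 ≤ p) (hp1 : p ≤ 1) (ha : |a - p| ≤ E)
    (hc : |c - 1| ≤ F) (hF : F ≤ 1 / 2) : |a / c - p| ≤ 2 * (E + F) := by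
  have hc' := abs_le.1 hc
  have hc0 : 1 / 2 ≤ c := by linarith
  have hE : 0 ≤ E := (abs_nonneg _).trans ha
  have hF0 : 0 ≤ F := (abs_nonneg _).trans hc
  have : a / c - p = ((a - p) - p * (c - 1)) / c := by
    field_simp
    ring
  rw [this, abs_div, abs_of_pos (by linarith : 0 < c), div_le_iff₀ (by linarith)]
  calc |a - p - p * (c - 1)| ≤ |a - p| + |p * (c - 1)| := abs_sub _ _
    _ ≤ E + F := by
        rw [abs_mul, abs_of_nonneg hp]
        have := mul_le_mul hp1 hc (abs_nonneg _) zero_le_one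
        linarith
    _ ≤ 2 * (E + F) * c := by nlinarith

/-- If `K · (h n)` is close to the Dirac kernel, then the normalized estimator is close to the
empirical frequency. -/
lemma abs_fHat_sub_empiricalFreq_le {Ω : Type*} {T : Set ℝ} {α E : ℝ} (hα : 0 < α)
    (hsep : ∀ y ∈ T, ∀ z ∈ T, z ≠ y → α ≤ |z - y|) {K : ℝ → ℝ → PMF ℝ} {h : ℕ → ℝ}
    {X : ℕ → Ω → ℝ} {n : ℕ} (hn : n ≠ 0) {ω : Ω} (hω : ∀ i, X i ω ∈ T)
    (hw : ∀ y ∈ T, ∀ z ∈ T, |(K y (h n) z).toReal - ({y} : Set ℝ).indicator 1 z| ≤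
      E * latticeWeight ⌊(y - z) / α⌋)
    (hE : ∀ y ∈ T, ∀ z ∈ T, |(K y (h n) z).toReal - ({y} : Set ℝ).indicator 1 z| ≤ E)
    (hsmall : E * ∑' j, latticeWeight j ≤ 1 / 2) {x : ℝ} (hx : x ∈ T) :
    |fHat T K h X n x ω - empiricalFreq X n x ω| ≤ 2 * (E + E * ∑' j, latticeWeight j) := by
  have hE0 : 0 ≤ E := (abs_nonneg _).trans (hE x hx x hx)
  have hmass := fun i => summable_and_abs_tsum_kernel_sub_one_le hα hsep hE0
    (k := fun y => K y (h n)) (hω i) fun y hy => hw y hy _ (hω i)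
  refine abs_div_sub_le (empiricalFreq_nonneg X n x ω) (empiricalFreq_le_one X hn x ω)
    (abs_average_sub_average_le hn fun i => hE x hx _ (hω i)) ?_ hsmall
  have hC : normConst T K h X n ω =
      1 / (n : ℝ) * ∑ i ∈ Finset.range n, ∑' y : T, (K y (h n) (X i ω)).toReal := by
    unfold normConst fTilde
    rw [tsum_mul_left, Summable.tsum_finsetSum fun i _ => (hmass i).1]
  have hone : (1 : ℝ) = 1 / (n : ℝ) * ∑ _i ∈ Finset.range n, (1 : ℝ) := by
    have : (n : ℝ) ≠ 0 := by exact_mod_cast hn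
    simp [this]
  rw [hC]
  calc _ = |_ - 1 / (n : ℝ) * ∑ _i ∈ Finset.range n, (1 : ℝ)| := by rw [← hone]
    _ ≤ _ := abs_average_sub_average_le hn fun i => (hmass i).2

lemma measurable_fHat {Ω : Type*} [MeasurableSpace Ω] {T : Set ℝ} [Countable T]
    (K : ℝ → ℝ → PMF ℝ) (h : ℕ → ℝ) {X : ℕ → Ω → ℝ} (hX : ∀ i, Measurable (X i)) (n : ℕ)
    (x : ℝ) : Measurable (fHat T K h X n x) := by
  have hmeas : ∀ y, Measurable (fTilde K h X n y) := fun y =>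
    (Finset.measurable_fun_sum _ fun i _ =>
      ((measurable_pmf (K y (h n))).comp (hX i)).ennreal_toReal).const_mul _
  have hnonneg : ∀ y ω, 0 ≤ fTilde K h X n y ω := fun y ω =>
    mul_nonneg (by positivity) (Finset.sum_nonneg fun _ _ => ENNReal.toReal_nonneg)
  -- The terms are nonnegative, so this also holds for a divergent sum, where both sides are `0`.
  have hC : normConst T K h X n =
      fun ω => (∑' y : T, ENNReal.ofReal (fTilde K h X n y ω)).toReal := by
    funext ω
    rw [ENNReal.tsum_toReal_eq fun _ => ENNReal.ofReal_ne_top]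
    simp only [ENNReal.toReal_ofReal (hnonneg _ ω)]
    rfl
  refine (hmeas x).div ?_
  rw [hC]
  exact (Measurable.tsum fun y : T => (hmeas y).ennreal_ofReal).ennreal_toReal

lemma measurable_indicator_singleton (x : ℝ) :
    Measurable (({x} : Set ℝ).indicator (1 : ℝ → ℝ)) :=
  measurable_one.indicator (measurableSet_singleton x)

/-- The central limit theorem for empirical frequencies. -/
lemma tendstoInDistribution_empiricalFreq {Ω : Type*} [MeasurableSpace Ω] {P : Measure Ω}
    [IsProbabilityMeasure P] {f : PMF ℝ} {X : ℕ → Ω → ℝ} (hX : ∀ i, Measurable (X i))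
    (hindep : iIndepFun X P) (hlaw : ∀ i, P.map (X i) = f.toMeasure) (x : ℝ) :
    TendstoInDistribution
      (fun (n : ℕ) (ω : Ω) => √(n : ℝ) * (empiricalFreq X n x ω - (f x).toReal))
      atTop (fun y : ℝ => y) (fun _ => P)
      (gaussianReal 0 (Real.toNNReal ((f x).toReal * (1 - (f x).toReal)))) := by
  set φ : ℝ → ℝ := ({x} : Set ℝ).indicator 1 with hφ
  have hφm : Measurable φ := measurable_indicator_singleton x
  have hmean : P[fun ω => φ (X 0 ω)] = (f x).toReal := by
    rw [← integral_map (hX 0).aemeasurable hφm.aestronglyMeasurable, hlaw 0, hφ,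
      integral_indicator_one (measurableSet_singleton x), measureReal_singleton_eq]
  have hL2 : MemLp (fun ω => φ (X 0 ω)) 2 P := by
    refine MemLp.of_bound (hφm.comp (hX 0)).aestronglyMeasurable 1 (ae_of_all _ fun ω => ?_)
    rw [hφ, Set.indicator_apply]
    split_ifs <;> simp
  have hsq : (fun ω => φ (X 0 ω)) ^ 2 = fun ω => φ (X 0 ω) := by
    funext ω
    simp only [Pi.pow_apply, hφ, Set.indicator_apply]
    split_ifs <;> simp
  have hvar : Var[fun ω => φ (X 0 ω); P] = (f x).toReal * (1 - (f x).toReal) := by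
    rw [variance_eq_sub hL2, hsq, hmean]
    ring
  have hclt := tendstoInDistribution_inv_sqrt_mul_sum_sub (P := P)
    (P' := gaussianReal 0 (Real.toNNReal ((f x).toReal * (1 - (f x).toReal))))
    (X := fun i ω => φ (X i ω)) (Y := fun y : ℝ => y)
    (by rw [hvar]; exact ⟨aemeasurable_id', Measure.map_id'⟩) hL2
    (hindep.comp (fun _ => φ) fun _ => hφm)
    (fun i => (IdentDistrib.mk (hX i).aemeasurable (hX 0).aemeasurable
      ((hlaw i).trans (hlaw 0).symm)).comp hφm)
  refine hclt.congr (fun n => ae_of_all _ fun ω => ?_) (ae_eq_refl _)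
  simp only [empiricalFreq]
  rw [hmean]
  rcases Nat.eq_zero_or_pos n with rfl | hn
  · simp
  · have hn' : (0 : ℝ) < n := by exact_mod_cast hn
    have hs : √(n : ℝ) ≠ 0 := by positivity
    have hs2 : (n : ℝ) = √(n : ℝ) * √(n : ℝ) := (Real.mul_self_sqrt hn'.le).symm
    set s := √(n : ℝ)
    rw [hs2]
    field_simp
    rfl

/-- The bandwidths are eventually such that the second moments of the kernels around their
targets are at most a multiple of the bandwidth. -/
lemma AssumptionA2.exists_integral_sub_sq_le {T : Set ℝ} {S : ℝ → Set ℝ} {K : ℝ → ℝ → PMF ℝ}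
    {h : ℕ → ℝ} (hA2 : AssumptionA2 T S K h) (hpos : ∀ n, 1 ≤ n → 0 < h n)
    (hh : Tendsto h atTop (𝓝 0)) :
    ∃ M : ℝ, ∀ᶠ n in atTop, ∀ y ∈ T,
      Integrable (fun z : ℝ => (z - y) ^ 2) (K y (h n)).toMeasure ∧
      ∫ z, (z - y) ^ 2 ∂(K y (h n)).toMeasure ≤ M * h n := by
  obtain ⟨c₁, hc₁⟩ := hA2.bias
  obtain ⟨c₂, hc₂⟩ := hA2.variance
  -- The squared bias is at most `c₁ ^ 2 * h n ^ 2`, hence at most `c₁ ^ 2 * h n` once `h n ≤ 1`.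
  refine ⟨c₂ + c₁ ^ 2, ?_⟩
  filter_upwards [hc₁, hc₂, hA2.moment, eventually_ge_atTop 1, hh.eventually_le_const one_pos]
    with n hb hv hm hn h1 y hy
  refine ⟨integrable_sub_sq (hm y hy) y, ?_⟩
  rw [integral_sub_sq_eq (hm y hy)]
  have hb' := sq_le_sq.2 ((hb y hy).trans (le_abs_self _))
  have hv' := hv y hy
  unfold kernelMean at hb'
  unfold kernelVar at hv'
  have h0 := hpos n hn
  have : c₁ ^ 2 * (h n * h n) ≤ c₁ ^ 2 * (h n * 1) := by gcongr
  nlinarith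

lemma tendsto_zero_of_sqrt_mul_tendsto_zero {h : ℕ → ℝ} (hpos : ∀ n, 1 ≤ n → 0 < h n)
    (hrate : Tendsto (fun n : ℕ => √(n : ℝ) * h n) atTop (𝓝 0)) : Tendsto h atTop (𝓝 0) := by
  refine squeeze_zero' ?_ ?_ hrate <;> filter_upwards [eventually_ge_atTop 1] with n hn
  · exact (hpos n hn).le
  · have : (1 : ℝ) ≤ √(n : ℝ) := Real.one_le_sqrt.2 (by exact_mod_cast hn)
    exact le_mul_of_one_le_left (hpos n hn).le this

/-- The normalized estimator is within `O(h n)` of the empirical frequency, uniformly over the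
samples drawn from the targets. -/
lemma exists_abs_fHat_sub_empiricalFreq_le {Ω : Type*} {T : Set ℝ} {S : ℝ → Set ℝ}
    (hTS : UniformlyDiscrete T S) {K : ℝ → ℝ → PMF ℝ} (hK : IsKernelOn T S K) {h : ℕ → ℝ}
    (hpos : ∀ n, 1 ≤ n → 0 < h n) (hA2 : AssumptionA2 T S K h) (hh : Tendsto h atTop (𝓝 0))
    (X : ℕ → Ω → ℝ) {x : ℝ} (hx : x ∈ T) :
    ∃ B : ℝ, ∀ᶠ n in atTop, ∀ ω, (∀ i, X i ω ∈ T) →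
      |fHat T K h X n x ω - empiricalFreq X n x ω| ≤ B * h n := by
  obtain ⟨α, hα, hsep⟩ := hTS
  obtain ⟨M, hM⟩ := hA2.exists_integral_sub_sq_le hpos hh
  set W := ∑' j, latticeWeight j
  refine ⟨2 * (M / α ^ 2 + M / α ^ 2 * W), ?_⟩
  have hsmall : Tendsto (fun n => M * h n / α ^ 2 * W) atTop (𝓝 0) := by
    simpa using ((hh.const_mul M).div_const (α ^ 2)).mul_const W
  filter_upwards [hM, eventually_ge_atTop 1,
    hsmall.eventually_le_const (by norm_num : (0 : ℝ) < 1 / 2)] with n hMn hn hsn ω hω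
  have key := fun y hy z hz => abs_kernel_sub_indicator_le hα hsep
    (k := fun y => K y (h n)) (fun y hy => hK y hy _ (hpos n hn))
    (fun y hy => (hMn y hy).1) (fun y hy => (hMn y hy).2) (y := y) (z := z) hy hz
  refine (abs_fHat_sub_empiricalFreq_le hα
    (fun y hy z hz hne => hsep y hy z ⟨Or.inl hz, hne⟩) (Nat.one_le_iff_ne_zero.1 hn) hω
    (fun y hy z hz => (key y hy z hz).1) (fun y hy z hz => (key y hy z hz).2) hsn hx).trans
    (le_of_eq ?_)
  ring

end DiscreteKernel

theorem theorem2 {Ω : Type*} [MeasurableSpace Ω] (P : Measure Ω) [IsProbabilityMeasure P]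
    (T : Set ℝ) (S : ℝ → Set ℝ) (hTS : DiscreteKernel.UniformlyDiscrete T S)
    (f : PMF ℝ) (hf : f.support ⊆ T)
    (X : ℕ → Ω → ℝ) (hX : ∀ i, Measurable (X i)) (hindep : iIndepFun X P)
    (hlaw : ∀ i, P.map (X i) = f.toMeasure)
    (K : ℝ → ℝ → PMF ℝ) (hK : DiscreteKernel.IsKernelOn T S K)
    (h : ℕ → ℝ) (hpos : ∀ n, 1 ≤ n → 0 < h n)
    (hA2 : DiscreteKernel.AssumptionA2 T S K h)
    (hrate : Tendsto (fun n : ℕ => √(n : ℝ) * h n) atTop (𝓝 0))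
    (x : ℝ) (hx : x ∈ T) (hfx : 0 < f x) :
    TendstoInDistribution
      (fun (n : ℕ) (ω : Ω) =>
        √(n : ℝ) * (DiscreteKernel.fHat T K h X n x ω - (f x).toReal))
      atTop (fun y : ℝ => y) (fun _ => P)
      (gaussianReal 0 (Real.toNNReal ((f x).toReal * (1 - (f x).toReal)))) := by
  obtain ⟨α, hα, hsep⟩ := id hTS
  have := DiscreteKernel.countable_of_separated hα
    fun y hy z hz hne => hsep y hy z ⟨Or.inl hz, hne⟩
  have hTm : MeasurableSet T := (Set.countable_coe_iff.1 this).measurableSet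
  -- The kernel bounds concern sample values in `T` only, so the comparison is almost sure.
  have hmem : ∀ᵐ ω ∂P, ∀ i, X i ω ∈ T := by
    refine ae_all_iff.2 fun i => ?_
    refine ae_of_ae_map (p := fun z => z ∈ T) (hX i).aemeasurable ?_
    rw [hlaw i]
    refine (mem_ae_iff_prob_eq_one hTm).2 ?_
    exact (f.toMeasure_apply_eq_one_iff hTm).2 hf
  obtain ⟨B, hB⟩ := DiscreteKernel.exists_abs_fHat_sub_empiricalFreq_le hTS hK hpos hA2
    (DiscreteKernel.tendsto_zero_of_sqrt_mul_tendsto_zero hpos hrate) X hx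
  have hclt := DiscreteKernel.tendstoInDistribution_empiricalFreq hX hindep hlaw x
  have hY : ∀ n : ℕ, AEMeasurable (fun ω =>
      √(n : ℝ) * (DiscreteKernel.fHat T K h X n x ω - (f x).toReal)) P := fun n =>
    (((DiscreteKernel.measurable_fHat K h hX n x).sub_const _).const_mul _).aemeasurable
  -- Slutsky: it remains to see that `√n` times the difference from the empirical frequency vanishes
  -- in probability.
  refine tendstoInDistribution_of_tendstoInMeasure_sub _ _ hclt ?_ hY
  refine tendstoInMeasure_of_tendsto_ae
    (fun n => ((hY n).sub (hclt.forall_aemeasurable n)).aestronglyMeasurable) ?_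
  filter_upwards [hmem] with ω hω
  refine squeeze_zero_norm' (a := fun n : ℕ => B * (√(n : ℝ) * h n)) ?_
    (by simpa using hrate.const_mul B)
  filter_upwards [hB] with n hn
  have := hn ω hω
  simp only [Pi.sub_apply]
  rw [← mul_sub, sub_sub_sub_cancel_right, Real.norm_eq_abs, abs_mul,
    abs_of_nonneg (Real.sqrt_nonneg _)]
  calc _ ≤ √(n : ℝ) * (B * h n) := mul_le_mul_of_nonneg_left this (Real.sqrt_nonneg _)
    _ = _ := by ring
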